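/- Let $\Sigma\subset\mathbb R^2$ be open with coordinates $(u,v)$, and let $f\colon\Sigma\to\mathbb R^3$ be a front with unit normal $\nu$, that is, $f$ and $\nu\colon\Sigma\to S^2$ are $C^\infty$, $\langle df_q(X),\nu(q)\rangle=0$ for all $q\in\Sigma$ and $X\in T_q\Sigma$, and $(f,\nu)$ is an immersion. A point is singular if $f$ is not an immersion there, and regular otherwise. Put $\lambda=\det(f_u,f_v,\nu)$. Let $p\in\Sigma$ be a singular point of the second kind: $d\lambda(p)\neq0$, and $\gamma'(0)$ and $\eta_p$ are linearly dependent, where $\gamma$ is a regular $C^\infty$ curve with $\gamma(0)=p$ and $\lambda\circ\gamma=0$, and $\eta$ is a nowhere vanishing $C^\infty$ vector field near $p$ with $df_q(\eta_q)=0$ at every singular point $q$. Suppose that the Gaussian curvature $K$ of $f$, defined at the regular points, is rationally continuous at $p$: there are a $C^\infty$ local coordinate system centered at $p$, with polar coordinates $(r,\theta)$, and a number $c\in\mathbb R$ such that, for all but finitely many $\theta\in[0,2\pi)$, the points with polar coordinates $(r,\theta)$ are regular for all sufficiently small $r>0$, and $K$ at these points tends to $c$ as $r\to0^+$. Then $p$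 is a sub-parabolic point of $f$. That is, on a neighborhood of $p$ there are a principal curvature $\kappa$ of $f$ that extends as a $C^\infty$ function to the whole neighborhood, the other principal curvature $\tilde\kappa$, defined at the regular points and unbounded near $p$ (so $\kappa+\tilde\kappa=2H$ and $\kappa\tilde\kappa=K$ at the regular points, with $H$ the mean curvature with respect to $\nu$), and a nowhere vanishing $C^\infty$ vector field $\widetilde V$ which at the regular points is a principal vector for $\tilde\kappa$, i.e. $-\langle df(X),d\nu(\widetilde V)\rangle=\tilde\kappa\,\langle df(X),df(\widetilde V)\rangle$ for every tangent vector $X$, such that the directional derivative $\widetilde V\kappa$ vanishes at $p$. -/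

import Mathlib

open Set Filter Topology
open scoped ContDiff

noncomputable section

namespace FrontGeometry

/-- Euclidean 3-space, the target of the surfaces considered here. -/
abbrev E3 : Type := EuclideanSpace ℝ (Fin 3)

/-- The partial derivative `∂/∂u` on the `(u,v)`-plane. -/
def pu {F : Type*} [NormedAddCommGroup F] [NormedSpace ℝ F] (g : ℝ × ℝ → F) (q : ℝ × ℝ) : F :=
  fderiv ℝ g q (1, 0)

/-- The partial derivative `∂/∂v` on the `(u,v)`-plane. -/
def pv {F : Type*} [NormedAddCommGroup F] [NormedSpace ℝ F] (g : ℝ × ℝ → F) (q : ℝ × ℝ) : F :=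
  fderiv ℝ g q (0, 1)

/-- The determinant of three vectors of Euclidean 3-space. -/
def det3 (a b c : E3) : ℝ :=
  Matrix.det (Matrix.of ![a.ofLp, b.ofLp, c.ofLp])

/-- `f : D → ℝ³` is a smooth frontal with smooth unit normal vector field `ν`. -/
structure IsFrontal (D : Set (ℝ × ℝ)) (f ν : ℝ × ℝ → E3) : Prop where
  smooth : ContDiffOn ℝ ∞ f D
  smooth_normal : ContDiffOn ℝ ∞ ν D
  norm_normal : ∀ q ∈ D, ‖ν q‖ = 1
  orthogonal : ∀ q ∈ D, ∀ X : ℝ × ℝ, inner ℝ (fderiv ℝ f q X) (ν q) = 0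

/-- `f` is a front with unit normal `ν`: a frontal such that `(f, ν)` is an immersion. -/
structure IsFront (D : Set (ℝ × ℝ)) (f ν : ℝ × ℝ → E3) : Prop extends IsFrontal D f ν where
  immersion : ∀ q ∈ D, Function.Injective
    (fun X : ℝ × ℝ => (fderiv ℝ f q X, fderiv ℝ ν q X))

/-- The set `S(f)` of singular points: points of `D` at which `f` is not an immersion. -/
def singularSet (D : Set (ℝ × ℝ)) (f : ℝ × ℝ → E3) : Set (ℝ × ℝ) :=
  {q | q ∈ D ∧ ¬ Function.Injective (fderiv ℝ f q)}

/-- The set of regular points of `f` in `D`. -/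
def regularSet (D : Set (ℝ × ℝ)) (f : ℝ × ℝ → E3) : Set (ℝ × ℝ) :=
  {q | q ∈ D ∧ Function.Injective (fderiv ℝ f q)}

/-- The signed area density function `λ = det(f_u, f_v, ν)`. -/
def areaDensity (f ν : ℝ × ℝ → E3) (q : ℝ × ℝ) : ℝ :=
  det3 (pu f q) (pv f q) (ν q)

/-- A singular point `p` is non-degenerate if `dλ(p) ≠ 0`. -/
def IsNondegenerateSingularPoint (D : Set (ℝ × ℝ)) (f ν : ℝ × ℝ → E3) (p : ℝ × ℝ) : Prop :=
  p ∈ singularSet D f ∧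
    (pu (areaDensity f ν) p, pv (areaDensity f ν) p) ≠ ((0, 0) : ℝ × ℝ)

/-- `γ : (-ε, ε) → D` is a smooth regular curve through `p = γ(0)` along which `λ` vanishes. -/
structure IsSingularCurve (D : Set (ℝ × ℝ)) (f ν : ℝ × ℝ → E3) (p : ℝ × ℝ)
    (ε : ℝ) (γ : ℝ → ℝ × ℝ) : Prop where
  pos : 0 < ε
  smooth : ContDiffOn ℝ ∞ γ (Ioo (-ε) ε)
  regular : ∀ t ∈ Ioo (-ε) ε, deriv γ t ≠ 0
  base : γ 0 = p
  mem : ∀ t ∈ Ioo (-ε) ε, γ t ∈ D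
  singular : ∀ t ∈ Ioo (-ε) ε, areaDensity f ν (γ t) = 0

/-- `η` is a null vector field on the open neighbourhood `U ⊆ D` of `p`: smooth, never vanishing,
and annihilated by `df` at the singular points of `f` in `U`. -/
structure IsNullVectorField (D : Set (ℝ × ℝ)) (f : ℝ × ℝ → E3) (p : ℝ × ℝ)
    (U : Set (ℝ × ℝ)) (η : ℝ × ℝ → ℝ × ℝ) : Prop where
  isOpen : IsOpen U
  mem : p ∈ U
  subset : U ⊆ D
  smooth : ContDiffOn ℝ ∞ η U
  ne_zero : ∀ q ∈ U, η q ≠ 0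
  null : ∀ q ∈ singularSet D f ∩ U, fderiv ℝ f q (η q) = 0

/-- `p` is a singular point of the second kind: it is non-degenerate, and the velocity at `p` of
the singular curve is linearly dependent on the null vector. (Near a non-degenerate singular point
a singular curve and a null vector field always exist, and their directions at `p` are unique, so
that the choice of `γ` and `η` does not matter.) -/
def IsSecondKind (D : Set (ℝ × ℝ)) (f ν : ℝ × ℝ → E3) (p : ℝ × ℝ) : Prop :=
  IsNondegenerateSingularPoint D f ν p ∧
    ∃ (ε : ℝ) (γ : ℝ → ℝ × ℝ) (U : Set (ℝ × ℝ)) (η : ℝ × ℝ → ℝ × ℝ),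
      IsSingularCurve D f ν p ε γ ∧ IsNullVectorField D f p U η ∧
        ¬ LinearIndependent ℝ ![deriv γ 0, η p]

/-- The first fundamental form `⟨df X, df Y⟩`. -/
def firstForm (f : ℝ × ℝ → E3) (q X Y : ℝ × ℝ) : ℝ :=
  inner ℝ (fderiv ℝ f q X) (fderiv ℝ f q Y)

/-- The second fundamental form `-⟨df X, dν Y⟩`. -/
def secondForm (f ν : ℝ × ℝ → E3) (q X Y : ℝ × ℝ) : ℝ :=
  -inner ℝ (fderiv ℝ f q X) (fderiv ℝ ν q Y)

/-- The Gaussian curvature `(LN - M²)/(EG - F²)`, meaningful at regular points only. -/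
def gaussCurvature (f ν : ℝ × ℝ → E3) (q : ℝ × ℝ) : ℝ :=
  (secondForm f ν q (1, 0) (1, 0) * secondForm f ν q (0, 1) (0, 1)
      - secondForm f ν q (1, 0) (0, 1) ^ 2) /
    (firstForm f q (1, 0) (1, 0) * firstForm f q (0, 1) (0, 1)
      - firstForm f q (1, 0) (0, 1) ^ 2)

/-- The mean curvature `(EN - 2FM + GL)/(2(EG - F²))`, meaningful at regular points only. -/
def meanCurvature (f ν : ℝ × ℝ → E3) (q : ℝ × ℝ) : ℝ :=
  (firstForm f q (1, 0) (1, 0) * secondForm f ν q (0, 1) (0, 1)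
      - 2 * firstForm f q (1, 0) (0, 1) * secondForm f ν q (1, 0) (0, 1)
      + firstForm f q (0, 1) (0, 1) * secondForm f ν q (1, 0) (1, 0)) /
    (2 * (firstForm f q (1, 0) (1, 0) * firstForm f q (0, 1) (0, 1)
      - firstForm f q (1, 0) (0, 1) ^ 2))

/-- A function `φ`, considered on the set `R` only, is rationally continuous at `p`: in a local
coordinate system centered at `p` (with inverse `Ψ`), for all but finitely many angles `θ` the ray
of angle `θ` issuing from `p` starts in `R`, and the limits of `φ` at `p` along these rays exist,
are finite, and do not depend on `θ`. -/
def RationallyContinuousAt (R : Set (ℝ × ℝ)) (φ : ℝ × ℝ → ℝ) (p : ℝ × ℝ) : Prop :=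
  ∃ Ψ : OpenPartialHomeomorph (ℝ × ℝ) (ℝ × ℝ),
    (0 : ℝ × ℝ) ∈ Ψ.source ∧ Ψ 0 = p ∧
    ContDiffOn ℝ ∞ Ψ Ψ.source ∧ ContDiffOn ℝ ∞ Ψ.symm Ψ.target ∧
    ∃ (c : ℝ) (A : Set ℝ), A.Finite ∧ ∀ θ ∈ Ico 0 (2 * Real.pi) \ A,
      (∀ᶠ r in 𝓝[>] (0 : ℝ), Ψ (r * Real.cos θ, r * Real.sin θ) ∈ R) ∧
      Tendsto (fun r : ℝ => φ (Ψ (r * Real.cos θ, r * Real.sin θ))) (𝓝[>] 0) (𝓝 c)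

/-- `k` and `k'` are, near `p`, the bounded and the unbounded principal curvature of `f`.
The bounded one is extended to a smooth function on the open neighbourhood `U` of `p`;
at regular points `k + k' = 2H` and `k k' = K`; and `k'` is unbounded near `p`. -/
structure IsPrincipalCurvaturePair (D : Set (ℝ × ℝ)) (f ν : ℝ × ℝ → E3) (p : ℝ × ℝ)
    (U : Set (ℝ × ℝ)) (k k' : ℝ × ℝ → ℝ) : Prop where
  isOpen : IsOpen U
  mem : p ∈ U
  subset : U ⊆ D
  smooth : ContDiffOn ℝ ∞ k U
  sum : ∀ q ∈ U ∩ regularSet D f, k q + k' q = 2 * meanCurvature f ν q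
  prod : ∀ q ∈ U ∩ regularSet D f, k q * k' q = gaussCurvature f ν q
  unbounded : ∀ C : ℝ, ∃ᶠ q in 𝓝[regularSet D f] p, C < |k' q|

/-- `V` is a principal vector field for the principal curvature `k'` on `U`: a smooth, never
vanishing vector field on `U` with `(II - k' I) V = 0` at the regular points of `f` in `U`. -/
structure IsPrincipalVectorField (D : Set (ℝ × ℝ)) (f ν : ℝ × ℝ → E3)
    (U : Set (ℝ × ℝ)) (k' : ℝ × ℝ → ℝ) (V : ℝ × ℝ → ℝ × ℝ) : Prop where
  smooth : ContDiffOn ℝ ∞ V U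
  ne_zero : ∀ q ∈ U, V q ≠ 0
  principal : ∀ q ∈ U ∩ regularSet D f, ∀ X : ℝ × ℝ,
    secondForm f ν q X (V q) = k' q * firstForm f q X (V q)

/-- `p` is a sub-parabolic point of `f`: the derivative of the bounded principal curvature `k` in
the direction of the principal vector `V` of the unbounded principal curvature `k'` vanishes at
`p`. (Near a non-degenerate singular point of a front, `k` and `k'` are unique, and `V` is unique
up to a nowhere vanishing factor.) -/
def IsSubParabolic (D : Set (ℝ × ℝ)) (f ν : ℝ × ℝ → E3) (p : ℝ × ℝ) : Prop :=
  ∃ (U : Set (ℝ × ℝ)) (k k' : ℝ × ℝ → ℝ) (V : ℝ × ℝ → ℝ × ℝ),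
    IsPrincipalCurvaturePair D f ν p U k k' ∧ IsPrincipalVectorField D f ν U k' V ∧
      fderiv ℝ k p (V p) = 0

end FrontGeometry

end

/-! Write `λ`, `μ`, `σ` for `areaDensity`, `normalDensity`, `meanDensity`. All three are smooth
across the singular set, and `K = μ / λ`, `H = σ / λ` at regular points (`gaussCurvature_eq`,
`meanCurvature_eq`). With `t = λ κ̃`, the principal curvatures are governed by `t² - 2 σ t + λ μ =
0`. The front condition gives `σ(p) ≠ 0` (`IsFront.meanDensity_ne_zero`), so one root `t` is smooth
with `t(p) = 2 σ(p) ≠ 0`. Then `κ = μ / t` is smooth and `κ̃ = t / λ` blows up.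

Rational continuity is used through `μ = K λ`: comparing slopes along two independent rays gives
`μ(p) = 0` and `dμ(p) = c dλ(p)` (`RationallyContinuousAt.fderiv_eq`). Hence `dκ(p) = (c / t(p))
dλ(p)`.

A principal field `V` for `κ̃` satisfies `λ dν(V) = -t df(V)`, so `df(V) = 0` at `p` and `V(p)` is a
null vector. At a singular point of the second kind the null direction is tangent to the singular
curve, so `dλ(V) = 0`, and therefore `dκ(V) = 0`. -/

namespace FrontGeometry

/-! ### Determinants of triples of vectors in Euclidean 3-space -/

theorem det3_eq (a b c : E3) :
    det3 a b c = a 0 * (b 1 * c 2 - b 2 * c 1) - a 1 * (b 0 * c 2 - b 2 * c 0)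
      + a 2 * (b 0 * c 1 - b 1 * c 0) := by
  simp [det3, Matrix.det_fin_three]
  ring

theorem inner_eq_sum (a b : E3) :
    inner ℝ a b = a 0 * b 0 + a 1 * b 1 + a 2 * b 2 := by
  simp [PiLp.inner_apply, Fin.sum_univ_three]
  ring

/-- A product of two determinants is the determinant of the mutual inner products; orthogonality to
the unit vector `n` reduces it to a 2×2 Gram determinant. -/
theorem det3_mul_det3 {n : E3} (hn : inner ℝ n n = (1 : ℝ)) {x y z w : E3}
    (hx : inner ℝ x n = (0 : ℝ)) (hy : inner ℝ y n = (0 : ℝ)) :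
    det3 x y n * det3 z w n
      = (inner ℝ x z : ℝ) * inner ℝ y w - (inner ℝ x w : ℝ) * inner ℝ y z := by
  have key : det3 x y n * det3 z w n
      = (inner ℝ n n : ℝ) * ((inner ℝ x z : ℝ) * inner ℝ y w - (inner ℝ x w : ℝ) * inner ℝ y z)
        + (inner ℝ x n : ℝ) * ((inner ℝ y z : ℝ) * inner ℝ w n - (inner ℝ y w : ℝ) * inner ℝ z n)
        - (inner ℝ y n : ℝ) *
          ((inner ℝ x z : ℝ) * inner ℝ w n - (inner ℝ x w : ℝ) * inner ℝ z n) := by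
    simp only [det3_eq, inner_eq_sum]
    ring
  rw [key, hn, hx, hy]
  ring

/-- The Plücker relation. Applied to `f_u, f_v, ν_u, ν_v` it says that `λ μ` is the determinant of
`λ A`, with `A` the shape operator. -/
theorem det3_plucker (a b c d n : E3) :
    det3 a b n * det3 c d n = det3 c b n * det3 a d n - det3 a c n * det3 d b n := by
  simp only [det3_eq]
  ring

/-- Cramer's rule in the plane orthogonal to `n`: coplanarity removes the normal component. It
expresses `λ dν` through `df` without dividing by `λ`. -/
theorem det3_smul_eq {n : E3} (hn : inner ℝ n n = (1 : ℝ)) {a b c : E3}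
    (ha : inner ℝ a n = (0 : ℝ)) (hb : inner ℝ b n = (0 : ℝ)) (hc : inner ℝ c n = (0 : ℝ)) :
    det3 a b n • c = det3 c b n • a + det3 a c n • b := by
  have hd : det3 a b c = 0 := by
    have : det3 a b c * (inner ℝ n n : ℝ) = det3 a b n * inner ℝ c n - det3 c b n * inner ℝ a n
        - det3 a c n * inner ℝ b n := by
      simp only [det3_eq, inner_eq_sum]
      ring
    rw [hn, ha, hb, hc] at this
    linarith
  have key : det3 a b n • c = det3 c b n • a + det3 a c n • b + det3 a b c • n := by
    ext i
    fin_cases i <;> simp [det3_eq] <;> ring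
  rw [key, hd, zero_smul, add_zero]

theorem inner_self_pos_of_ne_zero {a : E3} (ha : a ≠ 0) : (0 : ℝ) < inner ℝ a a :=
  real_inner_self_pos.2 ha

/-! ### The first order data of a front -/

/-- The density `det(ν_u, ν_v, ν)`. -/
noncomputable def normalDensity (ν : ℝ × ℝ → E3) (q : ℝ × ℝ) : ℝ :=
  det3 (pu ν q) (pv ν q) (ν q)

/-- The density `-(det(f_u, ν_v, ν) + det(ν_u, f_v, ν)) / 2`. -/
noncomputable def meanDensity (f ν : ℝ × ℝ → E3) (q : ℝ × ℝ) : ℝ :=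
  -(det3 (pu f q) (pv ν q) (ν q) + det3 (pu ν q) (pv f q) (ν q)) / 2

theorem fderiv_apply_eq {F : Type*} [NormedAddCommGroup F] [NormedSpace ℝ F] (g : ℝ × ℝ → F)
    (q X : ℝ × ℝ) : fderiv ℝ g q X = X.1 • pu g q + X.2 • pv g q := by
  have : X = X.1 • ((1, 0) : ℝ × ℝ) + X.2 • ((0, 1) : ℝ × ℝ) := by
    ext <;> simp
  conv_lhs => rw [this]
  rw [map_add, map_smul, map_smul]
  rfl

theorem contDiffOn_det3 {D : Set (ℝ × ℝ)} {a b c : ℝ × ℝ → E3} (ha : ContDiffOn ℝ ∞ a D)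
    (hb : ContDiffOn ℝ ∞ b D) (hc : ContDiffOn ℝ ∞ c D) :
    ContDiffOn ℝ ∞ (fun q => det3 (a q) (b q) (c q)) D := by
  rw [contDiffOn_euclidean] at ha hb hc
  simp only [det3_eq]
  have ha0 := ha 0
  have ha1 := ha 1
  have ha2 := ha 2
  have hb0 := hb 0
  have hb1 := hb 1
  have hb2 := hb 2
  have hc0 := hc 0
  have hc1 := hc 1
  have hc2 := hc 2
  exact ((ha0.mul ((hb1.mul hc2).sub (hb2.mul hc1))).sub
    (ha1.mul ((hb0.mul hc2).sub (hb2.mul hc0)))).add (ha2.mul ((hb0.mul hc1).sub (hb1.mul hc0)))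

theorem contDiffOn_fderiv_apply {F : Type*} [NormedAddCommGroup F] [NormedSpace ℝ F]
    {D : Set (ℝ × ℝ)} (hD : IsOpen D) {g : ℝ × ℝ → F} (hg : ContDiffOn ℝ ∞ g D) (X : ℝ × ℝ) :
    ContDiffOn ℝ ∞ (fun q => fderiv ℝ g q X) D :=
  (hg.fderiv_of_isOpen hD (m := ∞) (by simp)).clm_apply contDiffOn_const

section Frontal

variable {D : Set (ℝ × ℝ)} {f ν : ℝ × ℝ → E3}

theorem IsFrontal.contDiffOn_areaDensity (hf : IsFrontal D f ν) (hD : IsOpen D) :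
    ContDiffOn ℝ ∞ (areaDensity f ν) D :=
  contDiffOn_det3 (contDiffOn_fderiv_apply hD hf.smooth _) (contDiffOn_fderiv_apply hD hf.smooth _)
    hf.smooth_normal

theorem IsFrontal.contDiffOn_normalDensity (hf : IsFrontal D f ν) (hD : IsOpen D) :
    ContDiffOn ℝ ∞ (normalDensity ν) D :=
  contDiffOn_det3 (contDiffOn_fderiv_apply hD hf.smooth_normal _)
    (contDiffOn_fderiv_apply hD hf.smooth_normal _) hf.smooth_normal

theorem IsFrontal.contDiffOn_meanDensity (hf : IsFrontal D f ν) (hD : IsOpen D) :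
    ContDiffOn ℝ ∞ (meanDensity f ν) D := by
  have h1 : ContDiffOn ℝ ∞ (fun q => det3 (pu f q) (pv ν q) (ν q)) D :=
    contDiffOn_det3 (contDiffOn_fderiv_apply hD hf.smooth _)
      (contDiffOn_fderiv_apply hD hf.smooth_normal _) hf.smooth_normal
  have h2 : ContDiffOn ℝ ∞ (fun q => det3 (pu ν q) (pv f q) (ν q)) D :=
    contDiffOn_det3 (contDiffOn_fderiv_apply hD hf.smooth_normal _)
      (contDiffOn_fderiv_apply hD hf.smooth _) hf.smooth_normal
  exact (h1.add h2).neg.div_const 2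

theorem IsFrontal.inner_normal_self (hf : IsFrontal D f ν) {q : ℝ × ℝ} (hq : q ∈ D) :
    inner ℝ (ν q) (ν q) = (1 : ℝ) := by
  rw [real_inner_self_eq_norm_sq, hf.norm_normal q hq, one_pow]

theorem IsFrontal.differentiableAt_normal (hf : IsFrontal D f ν) (hD : IsOpen D) {q : ℝ × ℝ}
    (hq : q ∈ D) : DifferentiableAt ℝ ν q :=
  (hf.smooth_normal.contDiffAt (hD.mem_nhds hq)).differentiableAt (by simp)

theorem IsFrontal.inner_fderiv_normal (hf : IsFrontal D f ν) (hD : IsOpen D) {q : ℝ × ℝ}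
    (hq : q ∈ D) (X : ℝ × ℝ) : inner ℝ (fderiv ℝ ν q X) (ν q) = (0 : ℝ) := by
  have hν := hf.differentiableAt_normal hD hq
  have h1 : (fun x => (inner ℝ (ν x) (ν x) : ℝ)) =ᶠ[𝓝 q] fun _ => 1 := by
    filter_upwards [hD.mem_nhds hq] with x hx using hf.inner_normal_self hx
  have h2 := fderiv_inner_apply ℝ hν hν X
  rw [h1.fderiv_eq] at h2
  rw [real_inner_comm (fderiv ℝ ν q X) (ν q)] at h2
  simp at h2
  linarith

/-- Differentiating `⟨df X, ν⟩ = 0` turns both sides into `-⟨d²f(X, Y), ν⟩`, so the symmetry holds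
at singular points too. -/
theorem IsFrontal.inner_fderiv_comm (hf : IsFrontal D f ν) (hD : IsOpen D) {q : ℝ × ℝ}
    (hq : q ∈ D) (X Y : ℝ × ℝ) :
    (inner ℝ (fderiv ℝ f q X) (fderiv ℝ ν q Y) : ℝ)
      = inner ℝ (fderiv ℝ f q Y) (fderiv ℝ ν q X) := by
  have hfq := hf.smooth.contDiffAt (hD.mem_nhds hq)
  have hν := hf.differentiableAt_normal hD hq
  have hdf : DifferentiableAt ℝ (fderiv ℝ f) q :=
    (hfq.fderiv_right (m := ∞) (by simp)).differentiableAt (by simp)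
  have key : ∀ X Y : ℝ × ℝ, (inner ℝ (fderiv ℝ f q X) (fderiv ℝ ν q Y) : ℝ)
      = - inner ℝ (fderiv ℝ (fderiv ℝ f) q Y X) (ν q) := by
    intro X Y
    have h1 : (fun x => (inner ℝ (fderiv ℝ f x X) (ν x) : ℝ)) =ᶠ[𝓝 q] fun _ => 0 := by
      filter_upwards [hD.mem_nhds hq] with x hx using hf.orthogonal x hx X
    have h2 := fderiv_inner_apply ℝ (hdf.clm_apply (differentiableAt_const X)) hν Y
    rw [h1.fderiv_eq, fderiv_clm_apply hdf (differentiableAt_const X)] at h2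
    simp at h2
    linarith
  have hs : IsSymmSndFDerivAt ℝ f q := hfq.isSymmSndFDerivAt (by simp; exact WithTop.coe_le_coe.2 le_top)
  rw [key X Y, key Y X, hs Y X]

theorem IsFrontal.inner_pu (hf : IsFrontal D f ν) {q : ℝ × ℝ} (hq : q ∈ D) :
    inner ℝ (pu f q) (ν q) = (0 : ℝ) := hf.orthogonal q hq _

theorem IsFrontal.inner_pv (hf : IsFrontal D f ν) {q : ℝ × ℝ} (hq : q ∈ D) :
    inner ℝ (pv f q) (ν q) = (0 : ℝ) := hf.orthogonal q hq _

theorem IsFrontal.gram_eq (hf : IsFrontal D f ν) {q : ℝ × ℝ} (hq : q ∈ D) :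
    firstForm f q (1, 0) (1, 0) * firstForm f q (0, 1) (0, 1) - firstForm f q (1, 0) (0, 1) ^ 2
      = areaDensity f ν q ^ 2 := by
  have h := det3_mul_det3 (hf.inner_normal_self hq) (z := pu f q) (w := pv f q) (hf.inner_pu hq)
    (hf.inner_pv hq)
  rw [real_inner_comm (pu f q) (pv f q)] at h
  simp only [areaDensity, firstForm, sq]
  rw [h]
  rfl

theorem IsFrontal.areaDensity_ne_zero (hf : IsFrontal D f ν) {q : ℝ × ℝ}
    (hq : q ∈ regularSet D f) : areaDensity f ν q ≠ 0 := by
  intro h0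
  have hg := hf.gram_eq hq.1
  rw [h0] at hg
  set E : ℝ := inner ℝ (pu f q) (pu f q) with hE
  set F : ℝ := inner ℝ (pu f q) (pv f q) with hF
  set G : ℝ := inner ℝ (pv f q) (pv f q) with hG
  have hg' : E * G - F ^ 2 = 0 := by
    have : E * G - F ^ 2 = 0 ^ 2 := hg
    simpa using this
  have hinj := (injective_iff_map_eq_zero (fderiv ℝ f q)).1 hq.2
  -- The squared length of this vector is `E (E G - F²) = 0`.
  have hz : (-F) • pu f q + E • pv f q = 0 := by
    rw [← inner_self_eq_zero (𝕜 := ℝ)]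
    simp only [inner_add_left, inner_add_right, real_inner_smul_left, real_inner_smul_right]
    rw [real_inner_comm (pu f q) (pv f q), ← hE, ← hF, ← hG]
    linear_combination E * hg'
  have h1 := hinj (-F, E) (by rw [fderiv_apply_eq]; exact hz)
  have hE0 : E = 0 := congrArg Prod.snd h1
  have h2 := hinj (1, 0) (inner_self_eq_zero (𝕜 := ℝ).1 (hE.symm.trans hE0))
  have := congrArg Prod.fst h2
  norm_num at this

/-- The numerator `L N - M²` equals `λ μ` and the denominator is `λ²`, so one factor `λ` cancels. -/
theorem IsFrontal.gaussCurvature_eq (hf : IsFrontal D f ν) (hD : IsOpen D) {q : ℝ × ℝ}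
    (hq : q ∈ regularSet D f) :
    gaussCurvature f ν q = normalDensity ν q / areaDensity f ν q := by
  have hne := hf.areaDensity_ne_zero hq
  have h := det3_mul_det3 (hf.inner_normal_self hq.1) (z := pu ν q) (w := pv ν q)
    (hf.inner_pu hq.1) (hf.inner_pv hq.1)
  have hs : (inner ℝ (pu f q) (pv ν q) : ℝ) = inner ℝ (pv f q) (pu ν q) :=
    hf.inner_fderiv_comm hD hq.1 _ _
  have hnum : secondForm f ν q (1, 0) (1, 0) * secondForm f ν q (0, 1) (0, 1)
      - secondForm f ν q (1, 0) (0, 1) ^ 2 = areaDensity f ν q * normalDensity ν q := by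
    change (-inner ℝ (pu f q) (pu ν q)) * (-inner ℝ (pv f q) (pv ν q))
      - (-inner ℝ (pu f q) (pv ν q)) ^ 2 = det3 (pu f q) (pv f q) (ν q) *
        det3 (pu ν q) (pv ν q) (ν q)
    rw [h, ← hs]
    ring
  rw [gaussCurvature, hf.gram_eq hq.1, hnum]
  field_simp

theorem IsFrontal.meanCurvature_eq (hf : IsFrontal D f ν) (hD : IsOpen D) {q : ℝ × ℝ}
    (hq : q ∈ regularSet D f) :
    meanCurvature f ν q = meanDensity f ν q / areaDensity f ν q := by
  have hne := hf.areaDensity_ne_zero hq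
  have hn := hf.inner_normal_self hq.1
  have h1 := det3_mul_det3 hn (z := pu f q) (w := pv ν q) (hf.inner_pu hq.1) (hf.inner_pv hq.1)
  have h2 := det3_mul_det3 hn (z := pu ν q) (w := pv f q) (hf.inner_pu hq.1) (hf.inner_pv hq.1)
  have hs : (inner ℝ (pu f q) (pv ν q) : ℝ) = inner ℝ (pv f q) (pu ν q) :=
    hf.inner_fderiv_comm hD hq.1 _ _
  have hnum : firstForm f q (1, 0) (1, 0) * secondForm f ν q (0, 1) (0, 1)
      - 2 * firstForm f q (1, 0) (0, 1) * secondForm f ν q (1, 0) (0, 1)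
      + firstForm f q (0, 1) (0, 1) * secondForm f ν q (1, 0) (1, 0)
      = 2 * (areaDensity f ν q * meanDensity f ν q) := by
    change inner ℝ (pu f q) (pu f q) * (-inner ℝ (pv f q) (pv ν q))
      - 2 * inner ℝ (pu f q) (pv f q) * (-inner ℝ (pu f q) (pv ν q))
      + inner ℝ (pv f q) (pv f q) * (-inner ℝ (pu f q) (pu ν q))
      = 2 * (det3 (pu f q) (pv f q) (ν q) *
        (-(det3 (pu f q) (pv ν q) (ν q) + det3 (pu ν q) (pv f q) (ν q)) / 2))
    rw [real_inner_comm (pu f q) (pv f q)] at h1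
    rw [← hs] at h2
    linear_combination h1 + h2
  rw [meanCurvature, hf.gram_eq hq.1, hnum]
  field_simp

/-! ### Behaviour at a non-degenerate singular point -/

/-- Every term of `λ` contains a component of `f_u` times one of `f_v`, so `λ` vanishes to second
order where `df = 0`. Thus non-degeneracy forces `df(p) ≠ 0`. -/
theorem fderiv_areaDensity_eq_zero (hf : IsFrontal D f ν) (hD : IsOpen D) {p : ℝ × ℝ}
    (hp : p ∈ D) (hu : pu f p = 0) (hv : pv f p = 0) : fderiv ℝ (areaDensity f ν) p = 0 := by
  have hd : ∀ {g : ℝ × ℝ → E3}, ContDiffOn ℝ ∞ g D → ∀ i, DifferentiableAt ℝ (fun q => g q i) p :=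
    fun hg i => (((contDiffOn_euclidean.1 hg) i).contDiffAt (hD.mem_nhds hp)).differentiableAt
      (by simp)
  have ha := hd (contDiffOn_fderiv_apply hD hf.smooth (1, 0))
  have hb := hd (contDiffOn_fderiv_apply hD hf.smooth (0, 1))
  have hn := hd hf.smooth_normal
  have ha0 : ∀ i, (fderiv ℝ f p (1, 0)) i = 0 := fun i => by
    change (pu f p) i = 0
    rw [hu]; rfl
  have hb0 : ∀ i, (fderiv ℝ f p (0, 1)) i = 0 := fun i => by
    change (pv f p) i = 0
    rw [hv]; rfl
  -- Indices live in `Fin 3`, where `3 = 0`; for `i ≠ l`, `3 - i - l` is the remaining index.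
  have hm : ∀ i j k l, HasFDerivAt (fun q => (pu f q) i * ((pv f q) j * (ν q) k
      - (pv f q) l * (ν q) (3 - i - l))) (0 : ℝ × ℝ →L[ℝ] ℝ) p := by
    intro i j k l
    have h := (ha i).hasFDerivAt.mul (((hb j).hasFDerivAt.mul (hn k).hasFDerivAt).sub
      ((hb l).hasFDerivAt.mul (hn (3 - i - l)).hasFDerivAt))
    refine h.congr_fderiv ?_
    simp [ha0, hb0]
  have h := ((hm 0 1 2 2).sub (hm 1 0 2 2)).add (hm 2 0 1 1)
  simp only [sub_zero, add_zero] at h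
  refine HasFDerivAt.fderiv (h.congr_of_eventuallyEq (Eventually.of_forall fun q => ?_))
  simp only [areaDensity, det3_eq]
  rfl

/-- With `a, b, c, d` as `f_u, f_v, ν_u, ν_v`, the vector `w = d - t c` is `dν` of the null vector
`(-t, 1)`. The sum equals `det(a, w, n)`; symmetry makes `a ⟂ w`, so its square is `|a|² |w|² > 0`.
-/
theorem det3_add_det3_ne_zero_of_smul {n a b c d : E3} (hn : inner ℝ n n = (1 : ℝ))
    (ha : inner ℝ a n = (0 : ℝ)) (hc : inner ℝ c n = (0 : ℝ)) (hd : inner ℝ d n = (0 : ℝ))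
    (hs : (inner ℝ a d : ℝ) = inner ℝ b c) (ha0 : a ≠ 0) {t : ℝ} (hb : b = t • a)
    (hw : d - t • c ≠ 0) : det3 a d n + det3 c b n ≠ 0 := by
  have h1 : det3 a d n + det3 c b n = det3 a (d - t • c) n := by
    subst hb
    simp [det3_eq]
    ring
  have h2 : (inner ℝ a (d - t • c) : ℝ) = 0 := by
    rw [inner_sub_right, real_inner_smul_right, hs, hb, real_inner_smul_left]
    ring
  have hwn : inner ℝ (d - t • c) n = (0 : ℝ) := by
    rw [inner_sub_left, real_inner_smul_left, hc, hd]
    ring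
  have h3 := det3_mul_det3 hn (z := a) (w := d - t • c) ha hwn
  rw [h2, zero_mul, sub_zero] at h3
  rw [h1]
  intro h0
  rw [h0, zero_mul] at h3
  exact (mul_pos (inner_self_pos_of_ne_zero ha0) (inner_self_pos_of_ne_zero hw)).ne h3

theorem IsFront.meanDensity_ne_zero (hf : IsFront D f ν) (hD : IsOpen D) {p : ℝ × ℝ} (hp : p ∈ D)
    (hdf : ¬ (pu f p = 0 ∧ pv f p = 0)) {η : ℝ × ℝ} (hη : η ≠ 0) (hnull : fderiv ℝ f p η = 0) :
    meanDensity f ν p ≠ 0 := by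
  have hfr := hf.toIsFrontal
  have hn := hfr.inner_normal_self hp
  have hs : (inner ℝ (pu f p) (pv ν p) : ℝ) = inner ℝ (pv f p) (pu ν p) :=
    hfr.inner_fderiv_comm hD hp _ _
  have himm : ∀ X : ℝ × ℝ, X ≠ 0 → fderiv ℝ f p X = 0 → fderiv ℝ ν p X ≠ 0 := by
    intro X hX h1 h2
    exact hX (hf.immersion p hp (by simp [h1, h2]))
  have hc : inner ℝ (pu ν p) (ν p) = (0 : ℝ) := hfr.inner_fderiv_normal hD hp _
  have hd : inner ℝ (pv ν p) (ν p) = (0 : ℝ) := hfr.inner_fderiv_normal hD hp _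
  have hnull' := hnull
  rw [fderiv_apply_eq] at hnull'
  suffices h : det3 (pu f p) (pv ν p) (ν p) + det3 (pu ν p) (pv f p) (ν p) ≠ 0 by
    intro h0
    apply h
    unfold meanDensity at h0
    linarith
  -- If the null direction is `∂/∂u`, the roles of `u` and `v` are exchanged.
  by_cases hy : η.2 = 0
  · have hx : η.1 ≠ 0 := fun hx => hη (Prod.ext hx hy)
    have ha : pu f p = 0 := by simpa [hy, hx] using hnull'
    have hb : pv f p ≠ 0 := fun hb => hdf ⟨ha, hb⟩
    have h := det3_add_det3_ne_zero_of_smul hn (hfr.inner_pv hp) hd hc hs.symm hb (t := 0)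
      (by simp [ha]) (by
        have := himm (1, 0) (by simp) ha
        simpa [pu] using this)
    intro h0
    apply h
    rw [← neg_eq_zero, ← h0]
    simp only [det3_eq]
    ring
  · have hb : pv f p = (-(η.1 / η.2)) • pu f p := by
      have : η.2 • (pv f p - (-(η.1 / η.2)) • pu f p) = 0 := by
        rw [← hnull', smul_sub, smul_smul]
        rw [show η.2 * -(η.1 / η.2) = -η.1 by field_simp]
        module
      exact sub_eq_zero.1 ((smul_eq_zero.1 this).resolve_left hy)
    have ha : pu f p ≠ 0 := fun ha => hdf ⟨ha, by rw [hb, ha, smul_zero]⟩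
    refine det3_add_det3_ne_zero_of_smul hn (hfr.inner_pu hp) hc hd hs ha hb ?_
    have h := himm (η.1 / η.2, 1) (by simp) (by rw [fderiv_apply_eq, hb]; module)
    rw [fderiv_apply_eq] at h
    convert h using 1
    module

/-- The vector field `(λ A - λ k) e`, where `A` is the shape operator. -/
noncomputable def shapeField (f ν : ℝ × ℝ → E3) (k : ℝ × ℝ → ℝ) (e q : ℝ × ℝ) : ℝ × ℝ :=
  (-e.1 * (det3 (pu ν q) (pv f q) (ν q) + areaDensity f ν q * k q)
      - e.2 * det3 (pv ν q) (pv f q) (ν q),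
    -e.1 * det3 (pu f q) (pu ν q) (ν q)
      - e.2 * (det3 (pu f q) (pv ν q) (ν q) + areaDensity f ν q * k q))

theorem IsFrontal.contDiffOn_shapeField (hf : IsFrontal D f ν) (hD : IsOpen D) {U : Set (ℝ × ℝ)}
    (hU : U ⊆ D) {k : ℝ × ℝ → ℝ} (hk : ContDiffOn ℝ ∞ k U) (e : ℝ × ℝ) :
    ContDiffOn ℝ ∞ (shapeField f ν k e) U := by
  have ha := (contDiffOn_fderiv_apply hD hf.smooth (1, 0)).mono hU
  have hb := (contDiffOn_fderiv_apply hD hf.smooth (0, 1)).mono hU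
  have hc := (contDiffOn_fderiv_apply hD hf.smooth_normal (1, 0)).mono hU
  have hd := (contDiffOn_fderiv_apply hD hf.smooth_normal (0, 1)).mono hU
  have hn := hf.smooth_normal.mono hU
  have hl := ((hf.contDiffOn_areaDensity hD).mono hU).mul hk
  exact ((contDiffOn_const.mul ((contDiffOn_det3 hc hb hn).add hl)).sub
    (contDiffOn_const.mul (contDiffOn_det3 hd hb hn))).prodMk
    ((contDiffOn_const.mul (contDiffOn_det3 ha hc hn)).sub
      (contDiffOn_const.mul ((contDiffOn_det3 ha hd hn).add hl)))

/-- If `t + λ k = 2σ` and `t k = μ`, the field `(λ A - λ k) e` satisfies `λ dν V = -t df V`. -/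
theorem IsFrontal.areaDensity_smul_fderiv_shapeField (hf : IsFrontal D f ν) (hD : IsOpen D)
    {q : ℝ × ℝ} (hq : q ∈ D) {k : ℝ × ℝ → ℝ} {t : ℝ}
    (hsum : t + areaDensity f ν q * k q = 2 * meanDensity f ν q)
    (hprod : t * k q = normalDensity ν q) (e : ℝ × ℝ) :
    areaDensity f ν q • fderiv ℝ ν q (shapeField f ν k e q)
      = -(t • fderiv ℝ f q (shapeField f ν k e q)) := by
  have hn := hf.inner_normal_self hq
  have h1 := det3_smul_eq hn (hf.inner_pu hq) (hf.inner_pv hq)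
    (c := pu ν q) (hf.inner_fderiv_normal hD hq _)
  have h2 := det3_smul_eq hn (hf.inner_pu hq) (hf.inner_pv hq)
    (c := pv ν q) (hf.inner_fderiv_normal hD hq _)
  have h3 := det3_plucker (pu f q) (pv f q) (pu ν q) (pv ν q) (ν q)
  rw [fderiv_apply_eq, fderiv_apply_eq, smul_add, smul_comm _ _ (pu ν q), smul_comm _ _ (pv ν q)]
  simp only [areaDensity, normalDensity, meanDensity] at hsum hprod
  simp only [shapeField, areaDensity]
  rw [h1, h2]
  generalize det3 (pu f q) (pv f q) (ν q) = l at *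
  generalize det3 (pu ν q) (pv f q) (ν q) = x at *
  generalize det3 (pu f q) (pv ν q) (ν q) = y at *
  generalize det3 (pu f q) (pu ν q) (ν q) = z at *
  generalize det3 (pv ν q) (pv f q) (ν q) = w at *
  rw [← sub_eq_zero, sub_neg_eq_add]
  -- Cayley–Hamilton, `(λA - t)(λA - λk) e = 0`, by coordinates: `hsum` supplies the trace, `h3` and
  -- `hprod` the determinant.
  have e1 : (-e.1 * (x + l * k q) - e.2 * w) * (x + t) + (-e.1 * z - e.2 * (y + l * k q)) * w
      = 0 := by
    linear_combination (-e.1 * x - e.2 * w) * hsum - e.1 * h3 - e.1 * l * hprod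
  have e2 : (-e.1 * (x + l * k q) - e.2 * w) * z + (-e.1 * z - e.2 * (y + l * k q)) * (y + t)
      = 0 := by
    linear_combination (-e.1 * z - e.2 * y) * hsum - e.2 * h3 - e.2 * l * hprod
  trans ((-e.1 * (x + l * k q) - e.2 * w) * (x + t) + (-e.1 * z - e.2 * (y + l * k q)) * w) • pu f q
    + ((-e.1 * (x + l * k q) - e.2 * w) * z + (-e.1 * z - e.2 * (y + l * k q)) * (y + t)) • pv f q
  · module
  · rw [e1, e2, zero_smul, zero_smul, add_zero]

end Frontal

/-! ### Limits along rays -/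

/-- Since `g` and `h` vanish at `p`, the slope of `g` along the ray is `φ` times the slope of `h`;
pass to the limit. -/
theorem fderiv_eq_of_ray {g h φ : ℝ × ℝ → ℝ} {p : ℝ × ℝ} {R : Set (ℝ × ℝ)}
    (hg : DifferentiableAt ℝ g p) (hh : DifferentiableAt ℝ h p) (hh0 : h p = 0)
    (hφ : ∀ q ∈ R, g q = φ q * h q) {ρ : ℝ → ℝ × ℝ} {w : ℝ × ℝ} (hρ : HasDerivAt ρ w 0)
    (hρ0 : ρ 0 = p) (hR : ∀ᶠ r in 𝓝[>] (0 : ℝ), ρ r ∈ R) {c : ℝ}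
    (hc : Tendsto (fun r => φ (ρ r)) (𝓝[>] 0) (𝓝 c)) :
    g p = 0 ∧ fderiv ℝ g p w = c * fderiv ℝ h p w := by
  subst hρ0
  have hgd : HasDerivAt (g ∘ ρ) (fderiv ℝ g (ρ 0) w) 0 := hg.hasFDerivAt.comp_hasDerivAt 0 hρ
  have hhd : HasDerivAt (h ∘ ρ) (fderiv ℝ h (ρ 0) w) 0 := hh.hasFDerivAt.comp_hasDerivAt 0 hρ
  have hgc : Tendsto (g ∘ ρ) (𝓝[>] 0) (𝓝 (g (ρ 0))) :=
    hgd.continuousAt.tendsto.mono_left nhdsWithin_le_nhds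
  have hhc : Tendsto (h ∘ ρ) (𝓝[>] 0) (𝓝 (h (ρ 0))) :=
    hhd.continuousAt.tendsto.mono_left nhdsWithin_le_nhds
  have hg0 : g (ρ 0) = 0 := by
    have h1 := hc.mul hhc
    rw [hh0, mul_zero] at h1
    refine tendsto_nhds_unique hgc (h1.congr' ?_)
    filter_upwards [hR] with r hr using (hφ _ hr).symm
  refine ⟨hg0, ?_⟩
  have hsub : Ioi (0 : ℝ) ⊆ {0}ᶜ := fun x hx => ne_of_gt hx
  have hgs := (hasDerivAt_iff_tendsto_slope.1 hgd).mono_left (nhdsWithin_mono 0 hsub)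
  have hhs := (hasDerivAt_iff_tendsto_slope.1 hhd).mono_left (nhdsWithin_mono 0 hsub)
  refine tendsto_nhds_unique hgs ((hc.mul hhs).congr' ?_)
  filter_upwards [hR] with r hr
  simp only [slope_def_field, Function.comp, hg0, hh0, hφ _ hr]
  ring

/-- Two rays with independent directions determine a linear functional, and `dΨ` is invertible. A
ray inside `R` also shows that `R` accumulates at `p`. -/
theorem RationallyContinuousAt.fderiv_eq {R : Set (ℝ × ℝ)} {φ g h : ℝ × ℝ → ℝ} {p : ℝ × ℝ}
    (hφ : RationallyContinuousAt R φ p) (hg : DifferentiableAt ℝ g p)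
    (hh : DifferentiableAt ℝ h p) (hh0 : h p = 0) (hR : ∀ q ∈ R, g q = φ q * h q) :
    (𝓝[R] p).NeBot ∧ g p = 0 ∧ ∃ c : ℝ, fderiv ℝ g p = c • fderiv ℝ h p := by
  obtain ⟨Ψ, h0, hp, hs, hs', c, A, hA, hray⟩ := hφ
  have hΨ : DifferentiableAt ℝ Ψ 0 :=
    (hs.contDiffAt (Ψ.open_source.mem_nhds h0)).differentiableAt (by simp)
  have hpt : p ∈ Ψ.target := hp ▸ Ψ.map_source h0
  have hΨ' : DifferentiableAt ℝ Ψ.symm p :=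
    (hs'.contDiffAt (Ψ.open_target.mem_nhds hpt)).differentiableAt (by simp)
  have hsp : Ψ.symm p = 0 := by rw [← hp, Ψ.left_inv h0]
  have hbase : ∀ θ : ℝ, Ψ (0 * Real.cos θ, 0 * Real.sin θ) = p := by
    intro θ
    rw [← hp]
    simp [Prod.zero_eq_mk]
  have hray' : ∀ θ : ℝ, HasDerivAt (fun r : ℝ => Ψ (r * Real.cos θ, r * Real.sin θ))
      (fderiv ℝ Ψ 0 (Real.cos θ, Real.sin θ)) 0 := by
    intro θ
    have h1 : HasDerivAt (fun r : ℝ => ((r * Real.cos θ, r * Real.sin θ) : ℝ × ℝ))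
        (Real.cos θ, Real.sin θ) 0 := by
      simpa using ((hasDerivAt_id (0 : ℝ)).mul_const (Real.cos θ)).prodMk
        ((hasDerivAt_id (0 : ℝ)).mul_const (Real.sin θ))
    refine HasFDerivAt.comp_hasDerivAt (0 : ℝ) ?_ h1
    have : ((0 * Real.cos θ, 0 * Real.sin θ) : ℝ × ℝ) = 0 := by simp
    rw [this]
    exact hΨ.hasFDerivAt
  -- Distinct angles in `(0, π)` are never opposite, so `sin (θ₁ - θ₂) ≠ 0`.
  obtain ⟨θ₁, hθ₁, θ₂, hθ₂, hlt⟩ : ∃ θ₁ ∈ Ioo 0 Real.pi \ A, ∃ θ₂ ∈ Ioo 0 Real.pi \ A, θ₁ ≠ θ₂ :=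
    ((Ioo_infinite Real.pi_pos).sdiff hA).nontrivial
  have hmem : ∀ {θ : ℝ}, θ ∈ Ioo 0 Real.pi \ A → θ ∈ Ico 0 (2 * Real.pi) \ A := fun hθ =>
    ⟨⟨hθ.1.1.le, by linarith [hθ.1.2, Real.pi_pos]⟩, hθ.2⟩
  have key : ∀ {θ : ℝ}, θ ∈ Ioo 0 Real.pi \ A → g p = 0 ∧
      fderiv ℝ g p (fderiv ℝ Ψ 0 (Real.cos θ, Real.sin θ))
        = c * fderiv ℝ h p (fderiv ℝ Ψ 0 (Real.cos θ, Real.sin θ)) := fun hθ =>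
    fderiv_eq_of_ray hg hh hh0 hR (hray' _) (hbase _) (hray _ (hmem hθ)).1
      (hray _ (hmem hθ)).2
  refine ⟨?_, (key hθ₁).1, c, ?_⟩
  · have ht : Tendsto (fun r : ℝ => Ψ (r * Real.cos θ₁, r * Real.sin θ₁)) (𝓝[>] 0) (𝓝[R] p) := by
      refine tendsto_nhdsWithin_iff.2 ⟨?_, (hray _ (hmem hθ₁)).1⟩
      have := (hray' θ₁).continuousAt.tendsto.mono_left (nhdsWithin_le_nhds (s := Ioi 0))
      rwa [hbase] at this
    exact ht.neBot
  · set ℓ : ℝ × ℝ →L[ℝ] ℝ := (fderiv ℝ g p - c • fderiv ℝ h p).comp (fderiv ℝ Ψ 0) with hℓ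
    have hℓ0 : ∀ {θ : ℝ}, θ ∈ Ioo 0 Real.pi \ A → Real.cos θ * ℓ (1, 0) + Real.sin θ * ℓ (0, 1)
        = 0 := by
      intro θ hθ
      have h1 : ℓ (Real.cos θ, Real.sin θ) = 0 := by
        simp [hℓ, (key hθ).2]
      have h2 : ((Real.cos θ, Real.sin θ) : ℝ × ℝ)
          = Real.cos θ • ((1, 0) : ℝ × ℝ) + Real.sin θ • ((0, 1) : ℝ × ℝ) := by
        ext <;> simp
      rw [h2, map_add, map_smul, map_smul] at h1
      simpa using h1
    have e1 := hℓ0 hθ₁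
    have e2 := hℓ0 hθ₂
    have hsin : Real.sin (θ₁ - θ₂) ≠ 0 := by
      intro hz
      have := (Real.sin_eq_zero_iff_of_lt_of_lt (by linarith [hθ₁.1.1, hθ₂.1.2])
        (by linarith [hθ₁.1.2, hθ₂.1.1])).1 hz
      exact hlt (sub_eq_zero.1 this)
    have hu : ℓ (1, 0) = 0 := by
      refine (mul_eq_zero.1 (?_ : Real.sin (θ₁ - θ₂) * ℓ (1, 0) = 0)).resolve_left hsin
      rw [Real.sin_sub]
      linear_combination Real.sin θ₁ * e2 - Real.sin θ₂ * e1
    have hv : ℓ (0, 1) = 0 := by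
      refine (mul_eq_zero.1 (?_ : Real.sin (θ₁ - θ₂) * ℓ (0, 1) = 0)).resolve_left hsin
      rw [Real.sin_sub]
      linear_combination Real.cos θ₂ * e1 - Real.cos θ₁ * e2
    have hℓz : ∀ X, ℓ X = 0 := by
      intro X
      have h2 : X = X.1 • ((1, 0) : ℝ × ℝ) + X.2 • ((0, 1) : ℝ × ℝ) := by
        ext <;> simp
      rw [h2, map_add, map_smul, map_smul, hu, hv]
      simp
    have hinv : ∀ Y, fderiv ℝ Ψ 0 (fderiv ℝ Ψ.symm p Y) = Y := by
      intro Y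
      have h1 : HasFDerivAt (Ψ ∘ Ψ.symm) ((fderiv ℝ Ψ 0).comp (fderiv ℝ Ψ.symm p)) p :=
        HasFDerivAt.comp p (by rw [hsp]; exact hΨ.hasFDerivAt) hΨ'.hasFDerivAt
      have h2 : HasFDerivAt (Ψ ∘ Ψ.symm) (ContinuousLinearMap.id ℝ (ℝ × ℝ)) p := by
        refine (hasFDerivAt_id p).congr_of_eventuallyEq ?_
        filter_upwards [Ψ.open_target.mem_nhds hpt] with x hx using Ψ.right_inv hx
      have := congrArg (fun L : ℝ × ℝ →L[ℝ] ℝ × ℝ => L Y) (h1.unique h2)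
      simpa using this
    refine ContinuousLinearMap.ext fun Y => ?_
    have h1 := hℓz (fderiv ℝ Ψ.symm p Y)
    simp only [hℓ, ContinuousLinearMap.comp_apply, hinv, _root_.sub_apply] at h1
    exact sub_eq_zero.1 h1

/-! ### The null direction and the principal curvatures -/

theorem fderiv_areaDensity_null {D : Set (ℝ × ℝ)} {f ν : ℝ × ℝ → E3} (hf : IsFrontal D f ν)
    (hD : IsOpen D) {p : ℝ × ℝ} (hp : p ∈ D) {ε : ℝ} {γ : ℝ → ℝ × ℝ}
    (hγ : IsSingularCurve D f ν p ε γ) {η : ℝ × ℝ}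
    (hdep : ¬ LinearIndependent ℝ ![deriv γ 0, η]) : fderiv ℝ (areaDensity f ν) p η = 0 := by
  have h0 : (0 : ℝ) ∈ Ioo (-ε) ε := ⟨neg_lt_zero.2 hγ.pos, hγ.pos⟩
  have hγd : HasDerivAt γ (deriv γ 0) 0 :=
    ((hγ.smooth.contDiffAt (isOpen_Ioo.mem_nhds h0)).differentiableAt (by simp)).hasDerivAt
  have hl : DifferentiableAt ℝ (areaDensity f ν) (γ 0) := by
    rw [hγ.base]
    exact ((hf.contDiffOn_areaDensity hD).contDiffAt (hD.mem_nhds hp)).differentiableAt (by simp)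
  have h1 := hl.hasFDerivAt.comp_hasDerivAt 0 hγd
  have h2 : HasDerivAt (areaDensity f ν ∘ γ) 0 0 := by
    refine (hasDerivAt_const (0 : ℝ) (0 : ℝ)).congr_of_eventuallyEq ?_
    filter_upwards [isOpen_Ioo.mem_nhds h0] with t ht using hγ.singular t ht
  have h3 := h1.unique h2
  rw [hγ.base] at h3
  rw [LinearIndependent.pair_iff' (hγ.regular 0 h0)] at hdep
  push Not at hdep
  obtain ⟨a, ha⟩ := hdep
  rw [← ha, map_smul, h3, smul_zero]

/-- The kernel of a nonzero linear map on the plane is at most a line, so `V` is a multiple of `η`.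
-/
theorem eq_zero_of_proportional {F : Type*} [NormedAddCommGroup F] [NormedSpace ℝ F]
    {T : ℝ × ℝ →L[ℝ] F} (hT : T ≠ 0) {η V : ℝ × ℝ} (hη : η ≠ 0) (hTη : T η = 0) (hTV : T V = 0)
    {L : ℝ × ℝ →L[ℝ] ℝ} (hL : L η = 0) : L V = 0 := by
  have hdet : V.1 * η.2 - V.2 * η.1 = 0 := by
    by_contra hne
    apply hT
    refine ContinuousLinearMap.ext fun X => ?_
    have hX : (V.1 * η.2 - V.2 * η.1) • X
        = (X.1 * η.2 - X.2 * η.1) • V + (V.1 * X.2 - V.2 * X.1) • η := by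
      ext <;> simp <;> ring
    have h := congrArg T hX
    rw [map_smul, map_add, map_smul, map_smul, hTV, hTη, smul_zero, smul_zero, add_zero] at h
    simpa using (smul_eq_zero.1 h).resolve_left hne
  have h1 : η.1 • V = V.1 • η := by
    ext <;> simp <;> linarith
  have h2 : η.2 • V = V.2 • η := by
    ext <;> simp <;> linarith
  by_contra hne
  apply hη
  have e1 := congrArg L h1
  have e2 := congrArg L h2
  rw [map_smul, map_smul, hL, smul_zero] at e1 e2
  exact Prod.ext ((smul_eq_zero.1 e1).resolve_right hne) ((smul_eq_zero.1 e2).resolve_right hne)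

/-- The root `σ + s √(σ² - λ μ)` of `t² - 2 σ t + λ μ`. -/
noncomputable def principalRoot (f ν : ℝ × ℝ → E3) (s : ℝ) (q : ℝ × ℝ) : ℝ :=
  meanDensity f ν q + s * √(meanDensity f ν q ^ 2 - areaDensity f ν q * normalDensity ν q)

theorem principalRoot_quadratic {f ν : ℝ × ℝ → E3} {s : ℝ} (hs : s ^ 2 = 1) {q : ℝ × ℝ}
    (hq : 0 ≤ meanDensity f ν q ^ 2 - areaDensity f ν q * normalDensity ν q) :
    principalRoot f ν s q ^ 2 + areaDensity f ν q * normalDensity ν q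
      = 2 * meanDensity f ν q * principalRoot f ν s q := by
  have h := Real.sq_sqrt hq
  unfold principalRoot
  linear_combination (√(meanDensity f ν q ^ 2 - areaDensity f ν q * normalDensity ν q)) ^ 2 * hs + h

theorem IsFrontal.contDiffOn_principalRoot {D : Set (ℝ × ℝ)} {f ν : ℝ × ℝ → E3}
    (hf : IsFrontal D f ν) (hD : IsOpen D) (s : ℝ) {U : Set (ℝ × ℝ)} (hU : U ⊆ D)
    (hpos : ∀ q ∈ U, 0 < meanDensity f ν q ^ 2 - areaDensity f ν q * normalDensity ν q) :
    ContDiffOn ℝ ∞ (principalRoot f ν s) U := by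
  have hm := (hf.contDiffOn_meanDensity hD).mono hU
  have hl := (hf.contDiffOn_areaDensity hD).mono hU
  have hn := (hf.contDiffOn_normalDensity hD).mono hU
  exact hm.add (contDiffOn_const.mul
    (((hm.pow 2).sub (hl.mul hn)).sqrt fun q hq => (hpos q hq).ne'))

/-- Where `λ = 0` the field is the smooth extension of `λA` applied to `e`; that matrix has trace `2
σ ≠ 0`. -/
theorem exists_shapeField_ne_zero {f ν : ℝ × ℝ → E3} {p : ℝ × ℝ}
    (hl : areaDensity f ν p = 0) (hm : meanDensity f ν p ≠ 0) (k : ℝ × ℝ → ℝ) :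
    ∃ e : ℝ × ℝ, shapeField f ν k e p ≠ 0 := by
  by_contra! h
  apply hm
  have h1 := congrArg Prod.fst (h (1, 0))
  have h2 := congrArg Prod.snd (h (0, 1))
  simp [shapeField, hl] at h1 h2
  simp [meanDensity, h1, h2]

end FrontGeometry

/-! ### The sub-parabolic point -/

open FrontGeometry in
theorem proposition3p3 (D : Set (ℝ × ℝ)) (hD : IsOpen D)
    (f ν : ℝ × ℝ → FrontGeometry.E3) (hf : FrontGeometry.IsFront D f ν)
    (p : ℝ × ℝ) (hp : FrontGeometry.IsSecondKind D f ν p)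
    (hK : FrontGeometry.RationallyContinuousAt (FrontGeometry.regularSet D f)
      (FrontGeometry.gaussCurvature f ν) p) :
    FrontGeometry.IsSubParabolic D f ν p := by
  obtain ⟨⟨hsing, hnd⟩, ε, γ, W, η, hγ, hη, hdep⟩ := hp
  have hfr := hf.toIsFrontal
  have hpD : p ∈ D := hsing.1
  have hDp := hD.mem_nhds hpD
  have hl0 : areaDensity f ν p = 0 := by
    have := hγ.singular 0 ⟨neg_lt_zero.2 hγ.pos, hγ.pos⟩
    rwa [hγ.base] at this
  have hη0 : η p ≠ 0 := hη.ne_zero p hη.mem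
  have hnull : fderiv ℝ f p (η p) = 0 := hη.null p ⟨hsing, hη.mem⟩
  have hdl : fderiv ℝ (areaDensity f ν) p (η p) = 0 := fderiv_areaDensity_null hfr hD hpD hγ hdep
  have hdf : ¬ (pu f p = 0 ∧ pv f p = 0) := fun ⟨hu, hv⟩ => hnd (by
    simp [pu, pv, fderiv_areaDensity_eq_zero hfr hD hpD hu hv])
  have hT : fderiv ℝ f p ≠ 0 := fun h => hdf (by simp [pu, pv, h])
  have hm0 : meanDensity f ν p ≠ 0 := hf.meanDensity_ne_zero hD hpD hdf hη0 hnull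
  have hlS := (hfr.contDiffOn_areaDensity hD).contDiffAt hDp
  have hnS := (hfr.contDiffOn_normalDensity hD).contDiffAt hDp
  have hmS := (hfr.contDiffOn_meanDensity hD).contDiffAt hDp
  obtain ⟨hne, hn0, c, hdn⟩ := hK.fderiv_eq (g := normalDensity ν) (h := areaDensity f ν)
    (hnS.differentiableAt (by simp)) (hlS.differentiableAt (by simp)) hl0 (fun q hq => by
      rw [hfr.gaussCurvature_eq hD hq, div_mul_cancel₀ _ (hfr.areaDensity_ne_zero hq)])
  -- The sign that avoids cancellation: `√(σ²) = |σ|` at `p`, so the chosen root is `2 σ(p)` rather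
  -- than `0`.
  obtain ⟨s, hs, hsm⟩ : ∃ s : ℝ, s ^ 2 = 1 ∧ s * |meanDensity f ν p| = meanDensity f ν p := by
    rcases abs_cases (meanDensity f ν p) with h | h
    · exact ⟨1, by norm_num, by rw [h.1, one_mul]⟩
    · exact ⟨-1, by norm_num, by rw [h.1]; ring⟩
  set t := principalRoot f ν s with ht
  have htp : t p = 2 * meanDensity f ν p := by
    simp only [ht, principalRoot, hl0, zero_mul, sub_zero, Real.sqrt_sq_eq_abs, hsm]
    ring
  have htp0 : t p ≠ 0 := by
    rw [htp]
    exact mul_ne_zero two_ne_zero hm0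
  set k : ℝ × ℝ → ℝ := fun q => normalDensity ν q / t q with hk
  obtain ⟨e, he⟩ := exists_shapeField_ne_zero hl0 hm0 k
  set V := shapeField f ν k e with hV
  set P : Set (ℝ × ℝ) := D ∩
    {q | 0 < meanDensity f ν q ^ 2 - areaDensity f ν q * normalDensity ν q} with hP
  have hPp : P ∈ 𝓝 p := by
    refine inter_mem hDp ?_
    have hc := ((hmS.pow 2).sub (hlS.mul hnS)).continuousAt
    refine hc.eventually_const_lt ?_
    simpa [hl0] using pow_pos (abs_pos.2 hm0) 2
  have htP : ContDiffOn ℝ ∞ t P := hfr.contDiffOn_principalRoot hD s inter_subset_left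
    fun q hq => hq.2
  have htS := htP.contDiffAt hPp
  have hkS : ContDiffAt ℝ ∞ k p := hnS.div htS htp0
  set Q : Set (ℝ × ℝ) := P ∩ {q | t q ≠ 0} with hQ
  have hQp : Q ∈ 𝓝 p := inter_mem hPp (htS.continuousAt.eventually_ne htp0)
  have hkQ : ContDiffOn ℝ ∞ k Q :=
    ((hfr.contDiffOn_normalDensity hD).mono fun q hq => hq.1.1).div (htP.mono inter_subset_left)
      fun q hq => hq.2
  have hVQ : ContDiffOn ℝ ∞ V Q := hfr.contDiffOn_shapeField hD (fun q hq => hq.1.1) hkQ e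
  set U : Set (ℝ × ℝ) := interior (Q ∩ {q | V q ≠ 0}) with hU
  have hUp : p ∈ U := mem_interior_iff_mem_nhds.2
    (inter_mem hQp ((hVQ.contDiffAt hQp).continuousAt.eventually_ne he))
  have hUQ : U ⊆ Q := interior_subset.trans inter_subset_left
  have hUD : U ⊆ D := fun q hq => (hUQ hq).1.1
  have hprod : ∀ q ∈ U, t q * k q = normalDensity ν q := fun q hq =>
    mul_div_cancel₀ _ (hUQ hq).2
  have hsum : ∀ q ∈ U, t q + areaDensity f ν q * k q = 2 * meanDensity f ν q := by
    intro q hq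
    have h1 := principalRoot_quadratic hs (hUQ hq).1.2.le
    have h2 := hprod q hq
    refine mul_right_cancel₀ (hUQ hq).2 ?_
    linear_combination h1 + areaDensity f ν q * h2
  have hdir : ∀ q ∈ U, areaDensity f ν q • fderiv ℝ ν q (V q) = -(t q • fderiv ℝ f q (V q)) :=
    fun q hq => hfr.areaDensity_smul_fderiv_shapeField hD (hUD hq) (hsum q hq) (hprod q hq) e
  have hVnull : fderiv ℝ f p (V p) = 0 := by
    have h := hdir p hUp
    rw [hl0, zero_smul, eq_comm, neg_eq_zero] at h
    exact (smul_eq_zero.1 h).resolve_left htp0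
  have hdlV : fderiv ℝ (areaDensity f ν) p (V p) = 0 :=
    eq_zero_of_proportional hT hη0 hnull hVnull hdl
  refine ⟨U, k, fun q => t q / areaDensity f ν q, V, ⟨isOpen_interior, hUp, hUD, hkQ.mono hUQ,
    ?_, ?_, ?_⟩, ⟨hVQ.mono hUQ, fun q hq => (interior_subset hq).2, ?_⟩, ?_⟩
  · rintro q ⟨hqU, hq⟩
    have h0 := hfr.areaDensity_ne_zero hq
    rw [hfr.meanCurvature_eq hD hq]
    field_simp
    linarith [hsum q hqU]
  · rintro q ⟨hqU, hq⟩
    have h0 := hfr.areaDensity_ne_zero hq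
    rw [hfr.gaussCurvature_eq hD hq, ← hprod q hqU]
    ring
  -- The bound holds eventually; `hne` (regular points accumulate at `p`) makes it hold frequently.
  · intro C
    refine Eventually.frequently ?_
    have h1 : Tendsto (areaDensity f ν) (𝓝[regularSet D f] p) (𝓝[≠] 0) := by
      refine tendsto_nhdsWithin_iff.2 ⟨?_, ?_⟩
      · have := hlS.continuousAt.tendsto
        rw [hl0] at this
        exact this.mono_left nhdsWithin_le_nhds
      · filter_upwards [self_mem_nhdsWithin] with q hq using hfr.areaDensity_ne_zero hq
    have h2 : Tendsto (fun q => |t q| * |areaDensity f ν q|⁻¹) (𝓝[regularSet D f] p) atTop := by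
      refine Tendsto.pos_mul_atTop (abs_pos.2 htp0)
        (htS.continuousAt.abs.tendsto.mono_left nhdsWithin_le_nhds) ?_
      refine tendsto_inv_nhdsGT_zero.comp (tendsto_nhdsWithin_iff.2 ⟨?_, ?_⟩)
      · simpa using (h1.mono_right nhdsWithin_le_nhds).abs
      · filter_upwards [self_mem_nhdsWithin] with q hq
          using abs_pos.2 (hfr.areaDensity_ne_zero hq)
    filter_upwards [h2.eventually_gt_atTop C] with q hq
    rwa [abs_div, div_eq_mul_inv]
  · rintro q ⟨hqU, hq⟩ X
    have h0 := hfr.areaDensity_ne_zero hq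
    have h := congrArg (fun w : E3 => (inner ℝ (fderiv ℝ f q X) w : ℝ)) (hdir q hqU)
    simp only [inner_neg_right, real_inner_smul_right] at h
    simp only [secondForm, firstForm]
    field_simp
    linarith
  -- As `μ(p) = 0`, the product rule for `μ · t⁻¹` leaves only `dμ / t = c dλ / t`, which kills `V
  -- p`.
  · have h1 := (hnS.differentiableAt (by simp)).hasFDerivAt.mul
      ((htS.inv htp0).differentiableAt (by simp)).hasFDerivAt
    have h2 : fderiv ℝ k p = _ := HasFDerivAt.fderiv h1
    rw [h2, hn0, hdn]
    simp [hdlV]
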